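/- Let $k$ be a field and let $I=(f_1,f_2,f_3,f_4)\subset S=k[x,y,z]$ be the ideal generated by four general quadratic forms. Then the Hilbert(–Samuel) coefficients of $I$ are $(e_0,e_1,e_2,e_3)=(8,4,3,1)$; that is, for all large $s$, $$\ell(S/I^s)=8\binom{s+2}{3}-4\binom{s+1}{2}+3\binom{s}{1}-1 .$$ Here, for an ideal $I\subset S_n=k[x_1,\dots,x_n]$ with $S_n/I$ Artinian, the Hilbert coefficients $e_0,\dots,e_n$ of $I$ are the integers such that $\ell(S_n/I^s)=\sum_{i=0}^n(-1)^ie_i\binom{s+n-i-1}{n-i}$ for all large $s$. "General" means that there is a polynomial $P$ over $k$ in the $4\cdot 6=24$ coefficients of four quadratic forms, not vanishing at some quadruple of quadratic forms over $k$, such that the assertion holds for every quadruple with $P(f_1,f_2,f_3,f_4)\neq0$; moreover the same $P$ works for quadruples of quadratic forms over every extension field $K$ of $k$ (with $S=K[x,y,z]$). -/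

import Mathlib

/-- The exponent vectors of the monomials of degree two in `n` variables. -/
abbrev QuadMonomial (n : ℕ) : Type := {m : Fin n →₀ ℕ // m.degree = 2}

/-- The coefficients of an `r`-tuple of quadratic forms in `n` variables, that is, the
coordinates of the tuple as a point of the affine space with one coordinate for each pair
(index of a form, monomial of degree two). -/
def quadCoeffs {K : Type*} [CommSemiring K] {n r : ℕ} (f : Fin r → MvPolynomial (Fin n) K) :
    Fin r × QuadMonomial n → K :=
  fun p => (f p.1).coeff p.2.1

/-- `e₀, …, eₙ` are the Hilbert coefficients of the ideal `I` of `S = K[x₁, …, xₙ]`: for all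
large `s` the length of `S / I ^ s` is finite and equal to
`∑ i = 0, …, n, (-1) ^ i * e i * C(s + n - i - 1, n - i)`.
(The natural-number subtractions are honest for `s ≥ 1`.) -/
def IsHilbertCoefficients {K : Type*} [Field K] {n : ℕ} (I : Ideal (MvPolynomial (Fin n) K))
    (e : Fin (n + 1) → ℤ) : Prop :=
  ∀ᶠ s : ℕ in Filter.atTop, ∃ l : ℕ,
    Module.length (MvPolynomial (Fin n) K) (MvPolynomial (Fin n) K ⧸ I ^ s) = (l : ℕ∞) ∧
    (l : ℤ) = ∑ i : Fin (n + 1),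
      (-1) ^ (i : ℕ) * e i * (Nat.choose (s + n - (i : ℕ) - 1) (n - (i : ℕ)) : ℤ)

/-! Dually, four general quadrics are the common kernel of a pencil of functionals on quadratic
forms, hence of a pencil of symmetric 3×3 matrices `A`, `B` with entries φ(`X i * X j`); no factor 2
enters, so every characteristic is allowed. Over an algebraically closed field, if `det A ≠ 0` and
`det (t A - B)` has distinct roots, the pencil is diagonalized by a congruence, and the basis can be
rescaled so that both diagonal matrices have trace zero (`exists_simultaneous_diagonalization`).
Both functionals then kill yz, xz, xy and x² + y² + z², so by a dimension count these span the same
space as the four forms, up to a linear change of coordinates (`exists_span_eq_map_symmIdeal`). One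
ideal J = `symmIdeal` thus represents all general quadruples.

For J, with m the ideal of the variables, m^(2s+1) ⊆ J^s ⊆ m^(2s), and only degree 2s needs study.
There J^s contains every monomial involving all three variables, every x^a y^b + x^b y^a with a, b >
0 and its analogues, and x^(2s) + y^(2s) + z^(2s). These relations leave 3s - 1 monomials. The
latter are independent modulo J^s because J is symmetric: setting one variable to zero, the
degree-2s part of an element of J^s is invariant under swapping the other two
(`coeff_mapDomain_swap_of_mem`). Hence the dimension is C(2s+2, 3) + 3s - 1.

The dimension descends from the algebraic closure to `K`, and it equals the length because the
quotient is local with residue field `K`. -/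

section SymmetricIdeal

/-! ### Membership in powers of an ideal containing yz, xz, xy, x² + y² + z² -/

variable {R : Type*} [CommRing R] {J : Ideal R} {x y z : R}

theorem Ideal.pow_mul_pow_mem_pow_add {a b : R} {m n : ℕ} (ha : a ∈ J ^ m) (hb : b ∈ J ^ n) :
    a * b ∈ J ^ (m + n) := by
  rw [pow_add]
  exact Ideal.mul_mem_mul ha hb

/-- Put T_n = xy · xz · x^(2n) and q = x² + y² + z². Replacing x² by q - y² - z² gives T_(n+2) = q
T_(n+1) - (xy)² T_n - (xz)² T_n, a recursion compatible with the powers of J. -/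
theorem mul_mul_pow_even_mem (hu : y * z ∈ J) (hv : x * z ∈ J) (hw : x * y ∈ J)
    (hq : x ^ 2 + y ^ 2 + z ^ 2 ∈ J) (n : ℕ) :
    x * y * (x * z) * x ^ (2 * n) ∈ J ^ (n + 2) := by
  induction n using Nat.twoStepInduction with
  | zero => simpa [pow_two] using Ideal.mul_mem_mul hw hv
  | one =>
    have h1 : x * y * (x * z) * (x ^ 2 + y ^ 2 + z ^ 2) ∈ J ^ 3 := by
      have := Ideal.mul_mem_mul (Ideal.mul_mem_mul hw hv) hq
      simpa [pow_succ, mul_assoc] using this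
    have h2 : x * y * (x * y) * (y * z) ∈ J ^ 3 := by
      have := Ideal.mul_mem_mul (Ideal.mul_mem_mul hw hw) hu
      simpa [pow_succ, mul_assoc] using this
    have h3 : x * z * (x * z) * (y * z) ∈ J ^ 3 := by
      have := Ideal.mul_mem_mul (Ideal.mul_mem_mul hv hv) hu
      simpa [pow_succ, mul_assoc] using this
    convert sub_mem (sub_mem h1 h2) h3 using 1
    ring
  | more n ih1 ih2 =>
    have h1 := Ideal.pow_mul_pow_mem_pow_add ih2 (n := 1) (by simpa using hq)
    have h2 := Ideal.pow_mul_pow_mem_pow_add ih1 (Ideal.pow_mem_pow hw 2)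
    have h3 := Ideal.pow_mul_pow_mem_pow_add ih1 (Ideal.pow_mem_pow hv 2)
    convert sub_mem (sub_mem h1 h2) h3 using 1
    ring

/-- The monomial is (yz)^(s-a) (xz)^(s-b) (xy)^(s-c), and these exponents add up to s. -/
theorem pow_mul_pow_mul_pow_mem_of_le (hu : y * z ∈ J) (hv : x * z ∈ J) (hw : x * y ∈ J)
    {a b c s : ℕ} (ha : a ≤ s) (hb : b ≤ s) (hc : c ≤ s) (h : a + b + c = 2 * s) :
    x ^ a * y ^ b * z ^ c ∈ J ^ s := by
  have := Ideal.pow_mul_pow_mem_pow_add (Ideal.pow_mul_pow_mem_pow_add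
    (Ideal.pow_mem_pow hu (s - a)) (Ideal.pow_mem_pow hv (s - b))) (Ideal.pow_mem_pow hw (s - c))
  obtain ⟨i, rfl⟩ := Nat.exists_eq_add_of_le ha
  obtain ⟨j, hj⟩ := Nat.exists_eq_add_of_le hb
  obtain ⟨k, hk⟩ := Nat.exists_eq_add_of_le hc
  have e1 : a + i - a = i := by lia
  have e2 : a + i - b = j := by lia
  have e3 : a + i - c = k := by lia
  rw [e1, e2, e3] at this
  obtain rfl : a = j + k := by lia
  obtain rfl : b = i + k := by lia
  obtain rfl : c = i + j := by lia
  rw [show j + k + i = i + j + k by ring]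
  convert this using 1
  ring

/-- Split off (xy)^(b-1) (xz)^(c-1); what remains is xy · xz times an even power of x. -/
theorem pow_mul_pow_mul_pow_mem_of_lt (hu : y * z ∈ J) (hv : x * z ∈ J) (hw : x * y ∈ J)
    (hq : x ^ 2 + y ^ 2 + z ^ 2 ∈ J) {a b c s : ℕ} (has : s < a) (hb : 0 < b) (hc : 0 < c)
    (h : a + b + c = 2 * s) : x ^ a * y ^ b * z ^ c ∈ J ^ s := by
  obtain ⟨b, rfl⟩ := Nat.exists_eq_succ_of_ne_zero hb.ne'
  obtain ⟨c, rfl⟩ := Nat.exists_eq_succ_of_ne_zero hc.ne'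
  obtain ⟨n, rfl⟩ : ∃ n, s = b + c + (n + 2) := ⟨s - (b + c + 2), by lia⟩
  obtain rfl : a = b + c + 2 + 2 * n := by lia
  have := Ideal.pow_mul_pow_mem_pow_add (Ideal.pow_mul_pow_mem_pow_add (Ideal.pow_mem_pow hw b)
    (Ideal.pow_mem_pow hv c)) (mul_mul_pow_even_mem hu hv hw hq n)
  convert this using 1
  simp only [Nat.succ_eq_add_one]
  ring

theorem pow_mul_pow_mul_pow_mem (hu : y * z ∈ J) (hv : x * z ∈ J) (hw : x * y ∈ J)
    (hq : x ^ 2 + y ^ 2 + z ^ 2 ∈ J) {a b c s : ℕ} (ha : 0 < a) (hb : 0 < b) (hc : 0 < c)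
    (h : a + b + c = 2 * s) : x ^ a * y ^ b * z ^ c ∈ J ^ s := by
  rcases lt_or_ge s a with h1 | h1
  · exact pow_mul_pow_mul_pow_mem_of_lt hu hv hw hq h1 hb hc h
  rcases lt_or_ge s b with h2 | h2
  · have := pow_mul_pow_mul_pow_mem_of_lt (x := y) (y := x) (z := z) hv hu
      (by rwa [mul_comm]) (by rwa [add_comm (y ^ 2)]) h2 ha hc (by lia)
    rwa [mul_comm (y ^ b)] at this
  rcases lt_or_ge s c with h3 | h3
  · have := pow_mul_pow_mul_pow_mem_of_lt (x := z) (y := y) (z := x) (by rwa [mul_comm])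
      (by rwa [mul_comm]) (by rwa [mul_comm]) (by convert hq using 1; ring) h3 hb ha (by lia)
    convert this using 1
    ring
  · exact pow_mul_pow_mul_pow_mem_of_le hu hv hw h1 h2 h3 h

/-- Newton's recursion for the power sums of x² and y², with x² + y² written as q - z². The terms
with z² involve all three variables because b > 0, so they are already known to lie in the right
power. -/
theorem mul_pow_mul_pow_add_pow_mem (hu : y * z ∈ J) (hv : x * z ∈ J) (hw : x * y ∈ J)
    (hq : x ^ 2 + y ^ 2 + z ^ 2 ∈ J) (n : ℕ) {b : ℕ} (hb : 0 < b) :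
    (x * y) ^ b * (x ^ (2 * n) + y ^ (2 * n)) ∈ J ^ (b + n) := by
  have hz (n : ℕ) {b : ℕ} (hb : 0 < b) :
      z ^ 2 * ((x * y) ^ b * (x ^ (2 * n) + y ^ (2 * n))) ∈ J ^ (b + n + 1) := by
    have h1 := pow_mul_pow_mul_pow_mem hu hv hw hq (a := b + 2 * n) (b := b) (c := 2)
      (s := b + n + 1) (by lia) hb two_pos (by lia)
    have h2 := pow_mul_pow_mul_pow_mem hu hv hw hq (a := b) (b := b + 2 * n) (c := 2)
      (s := b + n + 1) hb (by lia) two_pos (by lia)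
    convert add_mem h1 h2 using 1
    ring
  induction n using Nat.twoStepInduction generalizing b with
  | zero => simpa using Ideal.mul_mem_right _ _ (Ideal.pow_mem_pow hw b)
  | one =>
    have h1 := Ideal.pow_mul_pow_mem_pow_add (Ideal.pow_mem_pow hw b) (n := 1) (by simpa using hq)
    have h2 := pow_mul_pow_mul_pow_mem hu hv hw hq (a := b) (b := b) (c := 2)
      (s := b + 1) hb hb two_pos (by lia)
    convert sub_mem h1 h2 using 1
    ring
  | more n ih1 ih2 =>
    have h1 := Ideal.pow_mul_pow_mem_pow_add (ih2 hb) (n := 1) (by simpa using hq)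
    -- The product x²y² in Newton's recursion is absorbed into (xy)^b, which is why b varies in the
    -- induction.
    have h2 := ih1 (b := b + 2) (by lia)
    rw [show b + 2 + n = b + (n + 2) by ring] at h2
    have h3 := hz (n + 1) hb
    rw [show b + (n + 1) + 1 = b + (n + 2) by ring] at h1 h3
    convert sub_mem (sub_mem h1 h3) h2 using 1
    ring

theorem pow_mul_pow_add_pow_mul_pow_mem (hu : y * z ∈ J) (hv : x * z ∈ J) (hw : x * y ∈ J)
    (hq : x ^ 2 + y ^ 2 + z ^ 2 ∈ J) {a b s : ℕ} (ha : 0 < a) (hb : 0 < b) (h : a + b = 2 * s) :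
    x ^ a * y ^ b + x ^ b * y ^ a ∈ J ^ s := by
  wlog hab : b ≤ a generalizing a b
  · rw [add_comm]
    exact this hb ha (by lia) (by lia)
  obtain ⟨n, rfl⟩ : ∃ n, s = b + n := ⟨s - b, by lia⟩
  obtain rfl : a = b + 2 * n := by lia
  convert mul_pow_mul_pow_add_pow_mem hu hv hw hq n hb using 1
  ring

/-- Newton's identity p_(n+3) = e₁ p_(n+2) - e₂ p_(n+1) + e₃ p_n in x², y², z²: here each e_i lies
in J^i. -/
theorem sum_pow_even_mem (hu : y * z ∈ J) (hv : x * z ∈ J) (hw : x * y ∈ J)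
    (hq : x ^ 2 + y ^ 2 + z ^ 2 ∈ J) (n : ℕ) :
    x ^ (2 * n) + y ^ (2 * n) + z ^ (2 * n) ∈ J ^ n := by
  have he : (y * z) ^ 2 + (x * z) ^ 2 + (x * y) ^ 2 ∈ J ^ 2 :=
    add_mem (add_mem (Ideal.pow_mem_pow hu 2) (Ideal.pow_mem_pow hv 2)) (Ideal.pow_mem_pow hw 2)
  have he3 : y * z * (x * z) * (x * y) ∈ J ^ 3 := by
    have := Ideal.mul_mem_mul (Ideal.mul_mem_mul hu hv) hw
    simpa [pow_succ, mul_assoc] using this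
  induction n using Nat.strong_induction_on with
  | _ n ih =>
    match n with
    | 0 => simp
    | 1 => simpa using hq
    | 2 =>
      convert sub_mem (Ideal.pow_mem_pow hq 2) (Ideal.mul_mem_left _ 2 he) using 1
      ring
    | n + 3 =>
      have h1 := Ideal.pow_mul_pow_mem_pow_add (ih (n + 2) (by lia)) (n := 1) (by simpa using hq)
      have h2 := Ideal.pow_mul_pow_mem_pow_add (ih (n + 1) (by lia)) he
      have h3 := Ideal.pow_mul_pow_mem_pow_add (ih n (by lia)) he3
      convert add_mem (sub_mem h1 h2) h3 using 1
      ring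

theorem span_pow_le_pow (hu : y * z ∈ J) (hv : x * z ∈ J) (hw : x * y ∈ J)
    (hq : x ^ 2 + y ^ 2 + z ^ 2 ∈ J) (s : ℕ) :
    Ideal.span {x, y, z} ^ (2 * s + 1) ≤ J ^ s := by
  set m := Ideal.span {x, y, z}
  have hx : x ∈ m := Ideal.subset_span (by simp)
  have hy : y ∈ m := Ideal.subset_span (by simp)
  have hz : z ∈ m := Ideal.subset_span (by simp)
  -- x³ = x q - y · xy - z · xz, and likewise for y³ and z³; every other cubic monomial is a
  -- variable times a product of two distinct ones.
  have key : m ^ 3 ≤ m * J := by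
    have x3 : x ^ 3 ∈ m * J := by
      convert sub_mem (sub_mem (Ideal.mul_mem_mul hx hq) (Ideal.mul_mem_mul hy hw))
        (Ideal.mul_mem_mul hz hv) using 1
      ring
    have y3 : y ^ 3 ∈ m * J := by
      convert sub_mem (sub_mem (Ideal.mul_mem_mul hy hq) (Ideal.mul_mem_mul hx hw))
        (Ideal.mul_mem_mul hz hu) using 1
      ring
    have z3 : z ^ 3 ∈ m * J := by
      convert sub_mem (sub_mem (Ideal.mul_mem_mul hz hq) (Ideal.mul_mem_mul hx hv))
        (Ideal.mul_mem_mul hy hu) using 1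
      ring
    rw [pow_succ, pow_two, Ideal.span_mul_span', Ideal.span_mul_span', Ideal.span_le]
    rintro _ ⟨_, ⟨a, ha, b, hb, rfl⟩, c, hc, rfl⟩
    simp only [Set.mem_insert_iff, Set.mem_singleton_iff] at ha hb hc
    simp only [SetLike.mem_coe]
    have hxy (t : R) (ht : t ∈ m) : t * (x * y) ∈ m * J := Ideal.mul_mem_mul ht hw
    have hxz (t : R) (ht : t ∈ m) : t * (x * z) ∈ m * J := Ideal.mul_mem_mul ht hv
    have hyz (t : R) (ht : t ∈ m) : t * (y * z) ∈ m * J := Ideal.mul_mem_mul ht hu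
    rcases ha with rfl | rfl | rfl <;> rcases hb with rfl | rfl | rfl <;>
      rcases hc with rfl | rfl | rfl <;>
    first
    | (convert x3 using 1; ring1)
    | (convert y3 using 1; ring1)
    | (convert z3 using 1; ring1)
    | (convert hxy _ hx using 1; ring1)
    | (convert hxy _ hy using 1; ring1)
    | (convert hxz _ hx using 1; ring1)
    | (convert hxz _ hz using 1; ring1)
    | (convert hyz _ hx using 1; ring1)
    | (convert hyz _ hy using 1; ring1)
    | (convert hyz _ hz using 1; ring1)
  induction s with
  | zero => simp
  | succ s ih =>
    calc m ^ (2 * (s + 1) + 1) = m ^ (2 * s) * m ^ 3 := by ring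
      _ ≤ m ^ (2 * s) * (m * J) := Ideal.mul_mono_right key
      _ = m ^ (2 * s + 1) * J := by ring
      _ ≤ J ^ s * J := Ideal.mul_mono_left ih
      _ = J ^ (s + 1) := (pow_succ _ _).symm

/-- If `σ` is congruent to the identity modulo `m` and fixes generators of `J ≤ m ^ 2` modulo `N`,
then it fixes the elements of `J ^ s` modulo `m ^ (2 * s + 1) ⊔ N`. -/
theorem map_sub_mem_of_mem_pow (σ : R →+* R) {m N : Ideal R} {G : Set R}
    (hσ : ∀ p, σ p - p ∈ m) (hG : ∀ g ∈ G, σ g - g ∈ N) (hm : Ideal.span G ≤ m ^ 2) (s : ℕ) {p : R}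
    (hp : p ∈ Ideal.span G ^ s) : σ p - p ∈ m ^ (2 * s + 1) ⊔ N := by
  have hσm (n : ℕ) (p : R) (hp : p ∈ m ^ n) : σ p ∈ m ^ n := by
    have : m ^ n ≤ (m ^ n).comap σ := by
      refine le_trans (Ideal.pow_right_mono ?_ n) (Ideal.le_comap_pow σ n)
      intro a ha
      simpa using add_mem (hσ a) ha
    exact this hp
  have h1 : ∀ b ∈ Ideal.span G, σ b - b ∈ m ^ 3 ⊔ N := by
    intro b hb
    induction hb using Submodule.span_induction with
    | mem g hg => exact Ideal.mem_sup_right (hG g hg)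
    | zero => simp
    | add a b _ _ ha hb =>
      convert add_mem ha hb using 1
      rw [map_add]; ring
    | smul h g hg ih =>
      -- σ(hg) - hg = (σh - h) σg + h (σg - g), with the first term in m · m².
      have := Ideal.mul_mem_mul (hσ h) (hσm 2 g (hm hg))
      rw [← pow_succ'] at this
      convert add_mem ((le_sup_left : m ^ 3 ≤ m ^ 3 ⊔ N) this) (Ideal.mul_mem_left _ h ih) using 1
      rw [smul_eq_mul, map_mul]; ring
  induction s generalizing p with
  | zero => simpa using Ideal.mem_sup_left (hσ p)
  | succ s ih =>
    rw [pow_succ] at hp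
    induction hp using Submodule.mul_induction_on' with
    | mem_mul_mem a ha b hb =>
      have hs : σ a ∈ m ^ (2 * s) := by
        refine hσm _ _ ?_
        rw [pow_mul]
        exact Ideal.pow_right_mono hm s ha
      -- The same splitting, now as σ(ab) - ab = σa (σb - b) + (σa - a) b.
      have h2 : σ a * (σ b - b) ∈ m ^ (2 * s) * (m ^ 3 ⊔ N) := Ideal.mul_mem_mul hs (h1 b hb)
      have h3 : (σ a - a) * b ∈ (m ^ (2 * s + 1) ⊔ N) * m ^ 2 := Ideal.mul_mem_mul (ih ha) (hm hb)
      rw [Ideal.mul_sup, ← pow_add] at h2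
      rw [Ideal.sup_mul, ← pow_add] at h3
      have h2' := sup_le_sup le_rfl (Ideal.mul_le_right : m ^ (2 * s) * N ≤ N) h2
      have h3' := sup_le_sup le_rfl (Ideal.mul_le_left : N * m ^ 2 ≤ N) h3
      rw [show 2 * s + 1 + 2 = 2 * (s + 1) + 1 by ring] at h3'
      rw [show 2 * s + 3 = 2 * (s + 1) + 1 by ring] at h2'
      convert add_mem h2' h3' using 1
      rw [map_mul]; ring
    | add a _ b _ ha hb =>
      convert add_mem ha hb using 1
      rw [map_add]; ring

end SymmetricIdeal

/-! ### Exponent vectors and the number of standard monomials -/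

open MvPolynomial

/-- The exponent vector `(a, b, c)`. -/
noncomputable def expVec (a b c : ℕ) : Fin 3 →₀ ℕ := Finsupp.equivFunOnFinite.symm ![a, b, c]

@[simp] theorem expVec_zero (a b c : ℕ) : expVec a b c 0 = a := rfl
@[simp] theorem expVec_one (a b c : ℕ) : expVec a b c 1 = b := rfl
@[simp] theorem expVec_two (a b c : ℕ) : expVec a b c 2 = c := rfl

@[simp] theorem expVec_degree (a b c : ℕ) : (expVec a b c).degree = a + b + c := by
  simp [Finsupp.degree_eq_sum, Fin.sum_univ_three]

theorem expVec_inj {a b c a' b' c' : ℕ} :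
    expVec a b c = expVec a' b' c' ↔ a = a' ∧ b = b' ∧ c = c' := by
  constructor
  · intro h
    exact ⟨DFunLike.congr_fun h 0, DFunLike.congr_fun h 1, DFunLike.congr_fun h 2⟩
  · rintro ⟨rfl, rfl, rfl⟩
    rfl

theorem expVec_eta (e : Fin 3 →₀ ℕ) : expVec (e 0) (e 1) (e 2) = e := by
  ext i
  fin_cases i <;> rfl

theorem monomial_expVec {R : Type*} [CommRing R] (a b c : ℕ) :
    monomial (expVec a b c) (1 : R) = X 0 ^ a * X 1 ^ b * X 2 ^ c := by
  rw [monomial_eq, Finsupp.prod_fintype _ _ (by simp), Fin.prod_univ_three]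
  simp

/-- The exponent vectors of the monomials that form a basis modulo the `s`-th power of
`symmIdeal`: all those of degree less than `2 * s` and some of those of degree `2 * s` in which
one of the variables does not occur. -/
def IsStandardExp (s : ℕ) (e : Fin 3 →₀ ℕ) : Prop :=
  e.degree < 2 * s ∨ (e.degree = 2 * s ∧
    ((e 2 = 0 ∧ e 0 < e 1) ∨ (e 0 = 0 ∧ e 1 < e 2) ∨ (e 1 = 0 ∧ 0 < e 0 ∧ e 0 < e 2)))

theorem card_degree_lt (n : ℕ) :
    ((Finset.range n).biUnion fun d => Finset.finsuppAntidiag (Finset.univ : Finset (Fin 3)) d).card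
      = (n + 2).choose 3 := by
  rw [Finset.card_biUnion]
  · simp only [Finset.card_finsuppAntidiag_nat_eq_choose, Finset.card_univ, Fintype.card_fin]
    induction n with
    | zero => rfl
    | succ n ih =>
      rw [Finset.sum_range_succ, ih, show n + 1 + 2 = (n + 2) + 1 by ring,
        Nat.choose_succ_succ' (n + 2) 2, add_comm, show 3 + n - 1 = n + 2 by lia,
        Nat.choose_symm_add]
  · intro i _ j _ hij
    rw [Function.onFun, Finset.disjoint_left]
    intro e he he'
    rw [Finset.mem_finsuppAntidiag] at he he'
    exact hij (he.1.symm.trans he'.1)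

theorem exists_finset_isStandardExp {s : ℕ} (hs : 0 < s) :
    ∃ T : Finset (Fin 3 →₀ ℕ), (∀ e, e ∈ T ↔ IsStandardExp s e) ∧
      T.card + 1 = (2 * s + 2).choose 3 + 3 * s := by
  classical
  set A := (Finset.range (2 * s)).biUnion
    fun d => Finset.finsuppAntidiag (Finset.univ : Finset (Fin 3)) d with hA
  set E₁ := (Finset.range s).image fun a => expVec a (2 * s - a) 0 with hE₁
  set E₂ := (Finset.range s).image fun a => expVec 0 a (2 * s - a) with hE₂
  -- This edge omits both ends: z^(2s) is already in `E₂`, and x^(2s) is not standard.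
  set E₃ := (Finset.Ico 1 s).image fun a => expVec a 0 (2 * s - a) with hE₃
  have memA (e) : e ∈ A ↔ e.degree < 2 * s := by
    simp [A, Finset.mem_finsuppAntidiag, Finsupp.degree_eq_sum]
  have mem₁ (e) : e ∈ E₁ ↔ e.degree = 2 * s ∧ e 2 = 0 ∧ e 0 < e 1 := by
    rw [← expVec_eta e]
    simp only [E₁, Finset.mem_image, Finset.mem_range, expVec_inj, expVec_degree, expVec_zero,
      expVec_one, expVec_two]
    constructor
    · rintro ⟨a, ha⟩
      lia
    · intro h
      exact ⟨e 0, by lia⟩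
  have mem₂ (e) : e ∈ E₂ ↔ e.degree = 2 * s ∧ e 0 = 0 ∧ e 1 < e 2 := by
    rw [← expVec_eta e]
    simp only [E₂, Finset.mem_image, Finset.mem_range, expVec_inj, expVec_degree, expVec_zero,
      expVec_one, expVec_two]
    constructor
    · rintro ⟨a, ha⟩
      lia
    · intro h
      exact ⟨e 1, by lia⟩
  have mem₃ (e) : e ∈ E₃ ↔ e.degree = 2 * s ∧ e 1 = 0 ∧ 0 < e 0 ∧ e 0 < e 2 := by
    rw [← expVec_eta e]
    simp only [E₃, Finset.mem_image, Finset.mem_Ico, expVec_inj, expVec_degree, expVec_zero,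
      expVec_one, expVec_two]
    constructor
    · rintro ⟨a, ha⟩
      lia
    · intro h
      exact ⟨e 0, by lia⟩
  have c₁ : E₁.card = s := by
    rw [hE₁, Finset.card_image_of_injective _ fun a b h => (expVec_inj.1 h).1, Finset.card_range]
  have c₂ : E₂.card = s := by
    rw [hE₂, Finset.card_image_of_injective _ fun a b h => (expVec_inj.1 h).2.1, Finset.card_range]
  have c₃ : E₃.card = s - 1 := by
    rw [hE₃, Finset.card_image_of_injective _ fun a b h => (expVec_inj.1 h).1, Nat.card_Ico]
  refine ⟨A ∪ (E₁ ∪ (E₂ ∪ E₃)), fun e => ?_, ?_⟩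
  · simp only [Finset.mem_union, memA, mem₁, mem₂, mem₃, IsStandardExp]
    tauto
  · rw [Finset.card_union_of_disjoint, Finset.card_union_of_disjoint, Finset.card_union_of_disjoint,
      c₁, c₂, c₃, card_degree_lt]
    · lia
    · rw [Finset.disjoint_left]
      intro e
      rw [mem₂, mem₃]
      lia
    · rw [Finset.disjoint_left]
      intro e
      rw [Finset.mem_union, mem₁, mem₂, mem₃]
      lia
    · rw [Finset.disjoint_left]
      intro e
      rw [Finset.mem_union, Finset.mem_union, memA, mem₁, mem₂, mem₃]
      lia

/-! ### The standard monomials form a basis modulo `symmIdeal F ^ s` -/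

section

variable (F : Type*) [Field F]

/-- The ideal generated by the products of two different variables and by the sum of the squares
of the variables. -/
noncomputable def symmIdeal : Ideal (MvPolynomial (Fin 3) F) :=
  Ideal.span {X 1 * X 2, X 0 * X 2, X 0 * X 1, X 0 ^ 2 + X 1 ^ 2 + X 2 ^ 2}

variable {F}

theorem monomial_mem_symmIdeal_pow {a b c s : ℕ} (h : 2 * s < a + b + c) :
    (X 0 ^ a * X 1 ^ b * X 2 ^ c : MvPolynomial (Fin 3) F) ∈ symmIdeal F ^ s := by
  refine span_pow_le_pow (x := X 0) (y := X 1) (z := X 2) (Ideal.subset_span (by simp))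
    (Ideal.subset_span (by simp)) (Ideal.subset_span (by simp)) (Ideal.subset_span (by simp)) s
    (Ideal.pow_le_pow_right h ?_)
  refine Ideal.pow_mul_pow_mem_pow_add (Ideal.pow_mul_pow_mem_pow_add
    (Ideal.pow_mem_pow (Ideal.subset_span ?_) _) (Ideal.pow_mem_pow (Ideal.subset_span ?_) _))
    (Ideal.pow_mem_pow (Ideal.subset_span ?_) _) <;> simp

/-- The spanning half. In degree 2s, a nonstandard monomial in exactly two variables is either in
the power or traded for its mirror image, and the power sum relation disposes of x^(2s). -/
theorem monomial_mem_symmIdeal_pow_sup (s : ℕ) (e : Fin 3 →₀ ℕ) :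
    monomial e (1 : F) ∈ (symmIdeal F ^ s).restrictScalars F ⊔
      Submodule.span F ((fun e => monomial e (1 : F)) '' {e | IsStandardExp s e}) := by
  set N := (symmIdeal F ^ s).restrictScalars F ⊔
    Submodule.span F ((fun e => monomial e (1 : F)) '' {e | IsStandardExp s e}) with hN
  have hJ (p) (hp : p ∈ symmIdeal F ^ s) : p ∈ N := Submodule.mem_sup_left hp
  have hT (a b c : ℕ) (h : IsStandardExp s (expVec a b c)) :
      (X 0 ^ a * X 1 ^ b * X 2 ^ c : MvPolynomial (Fin 3) F) ∈ N := by
    rw [← monomial_expVec]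
    exact Submodule.mem_sup_right (Submodule.subset_span ⟨_, h, rfl⟩)
  have hu : (X 1 * X 2 : MvPolynomial (Fin 3) F) ∈ symmIdeal F := Ideal.subset_span (by simp)
  have hv : (X 0 * X 2 : MvPolynomial (Fin 3) F) ∈ symmIdeal F := Ideal.subset_span (by simp)
  have hw : (X 0 * X 1 : MvPolynomial (Fin 3) F) ∈ symmIdeal F := Ideal.subset_span (by simp)
  have hq : (X 0 ^ 2 + X 1 ^ 2 + X 2 ^ 2 : MvPolynomial (Fin 3) F) ∈ symmIdeal F :=
    Ideal.subset_span (by simp)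
  rw [← expVec_eta e]
  generalize e 0 = a, e 1 = b, e 2 = c
  by_cases hstd : IsStandardExp s (expVec a b c)
  · rw [monomial_expVec]; exact hT _ _ _ hstd
  simp only [IsStandardExp, expVec_degree, expVec_zero, expVec_one, expVec_two] at hstd hT
  rw [monomial_expVec]
  rcases lt_or_ge (2 * s) (a + b + c) with h | h
  · exact hJ _ (monomial_mem_symmIdeal_pow h)
  replace h : a + b + c = 2 * s := by lia
  by_cases hle : a ≤ s ∧ b ≤ s ∧ c ≤ s
  · exact hJ _ (pow_mul_pow_mul_pow_mem_of_le hu hv hw hle.1 hle.2.1 hle.2.2 h)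
  by_cases hpos : 0 < a ∧ 0 < b ∧ 0 < c
  · exact hJ _ (pow_mul_pow_mul_pow_mem hu hv hw hq hpos.1 hpos.2.1 hpos.2.2 h)
  by_cases h1 : c = 0 ∧ 0 < a ∧ 0 < b
  · have := sub_mem (hJ _ (pow_mul_pow_add_pow_mul_pow_mem hu hv hw hq h1.2.1 h1.2.2
      (s := s) (by lia))) (hT b a 0 (by lia))
    convert this using 1
    rw [h1.1]; ring
  by_cases h2 : a = 0 ∧ 0 < b ∧ 0 < c
  · have := sub_mem (hJ _ (pow_mul_pow_add_pow_mul_pow_mem (x := X 1) (y := X 2) (z := X 0)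
      (by rwa [mul_comm]) (by rwa [mul_comm]) hu (by convert hq using 1; ring) h2.2.1 h2.2.2
      (s := s) (by lia))) (hT 0 c b (by lia))
    convert this using 1
    rw [h2.1]; ring
  by_cases h3 : b = 0 ∧ 0 < a ∧ 0 < c
  · have := sub_mem (hJ _ (pow_mul_pow_add_pow_mul_pow_mem (x := X 0) (y := X 2) (z := X 1)
      (by rwa [mul_comm]) hw hv (by convert hq using 1; ring) h3.2.1 h3.2.2
      (s := s) (by lia))) (hT c 0 a (by lia))
    convert this using 1
    rw [h3.1]; ring
  have hs : 0 < s := by lia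
  -- Only x^(2s) is left.
  have := sub_mem (sub_mem (hJ _ (sum_pow_even_mem hu hv hw hq s)) (hT 0 (2 * s) 0 (by lia)))
    (hT 0 0 (2 * s) (by lia))
  obtain ⟨rfl, rfl, rfl⟩ : a = 2 * s ∧ b = 0 ∧ c = 0 := by lia
  convert this using 1
  ring

theorem symmIdeal_le : symmIdeal F ≤ idealOfVars (Fin 3) F ^ 2 := by
  have h (i j : Fin 3) : (X i * X j : MvPolynomial (Fin 3) F) ∈ idealOfVars (Fin 3) F ^ 2 := by
    rw [pow_two]
    exact Ideal.mul_mem_mul (Ideal.subset_span ⟨i, rfl⟩) (Ideal.subset_span ⟨j, rfl⟩)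
  rw [symmIdeal, Ideal.span_le]
  rintro p hp
  simp only [Set.mem_insert_iff, Set.mem_singleton_iff] at hp
  rcases hp with rfl | rfl | rfl | rfl
  · exact h _ _
  · exact h _ _
  · exact h _ _
  · simp only [pow_two (X _)]
    exact add_mem (add_mem (h _ _) (h _ _)) (h _ _)

theorem coeff_rename_swap (i j : Fin 3) (p : MvPolynomial (Fin 3) F) (e : Fin 3 →₀ ℕ) :
    coeff e (rename (Equiv.swap i j) p) = coeff (e.mapDomain (Equiv.swap i j)) p := by
  conv_lhs => rw [show e = (e.mapDomain (Equiv.swap i j)).mapDomain (Equiv.swap i j) by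
    rw [← Finsupp.mapDomain_comp, ← Equiv.coe_trans]; simp]
  rw [coeff_rename_mapDomain _ (Equiv.injective _)]

/-- Modulo `X l`, the swap of the other two variables fixes every generator of J, so it moves p only
within m^(2s+1) + (`X l`). No element of that ideal has a monomial of degree 2s free of `X l`. -/
theorem coeff_mapDomain_swap_of_mem {s : ℕ} {p : MvPolynomial (Fin 3) F}
    (hp : p ∈ symmIdeal F ^ s) (i j l : Fin 3) (hij : i ≠ j) (hil : i ≠ l) (hjl : j ≠ l)
    (e : Fin 3 →₀ ℕ) (he : e.degree = 2 * s) (hl : e l = 0) :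
    coeff (e.mapDomain (Equiv.swap i j)) p = coeff e p := by
  have key := map_sub_mem_of_mem_pow (rename (R := F) (Equiv.swap i j)).toRingHom
    (m := idealOfVars (Fin 3) F) (N := Ideal.span {X l})
    (G := {X 1 * X 2, X 0 * X 2, X 0 * X 1, X 0 ^ 2 + X 1 ^ 2 + X 2 ^ 2}) ?_ ?_ symmIdeal_le s hp
  · rw [Submodule.mem_sup] at key
    obtain ⟨y, hy, z, hz, hyz⟩ := key
    have h1 : coeff e y = 0 := (mem_pow_idealOfVars_iff' _ _).1 hy e (by lia)
    have h2 : coeff e z = 0 := by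
      obtain ⟨w, rfl⟩ := Ideal.mem_span_singleton'.1 hz
      rw [coeff_mul_X', if_neg]
      simpa using hl
    have := congrArg (coeff e) hyz
    rw [coeff_add, h1, h2, coeff_sub] at this
    rw [← coeff_rename_swap]
    rw [add_zero] at this
    exact sub_eq_zero.1 this.symm
  · intro p
    rw [← pow_one (idealOfVars (Fin 3) F), mem_pow_idealOfVars_iff']
    intro x hx
    obtain rfl : x = 0 := (Finsupp.degree_eq_zero_iff x).1 (by lia)
    have := coeff_rename_swap i j p 0
    simp only [Finsupp.mapDomain_zero] at this
    simp [this]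
  · intro g hg
    simp only [Set.mem_insert_iff, Set.mem_singleton_iff] at hg
    have h1 (a b : Fin 3) (hab : a ≠ b) : (X (Equiv.swap i j a) * X (Equiv.swap i j b) - X a * X b :
        MvPolynomial (Fin 3) F) ∈ Ideal.span {X l} := by
      rw [Ideal.mem_span_singleton]
      have : (a = l ∨ b = l) ∨ (a = i ∧ b = j) ∨ (a = j ∧ b = i) := by lia
      have hsl : Equiv.swap i j l = l := Equiv.swap_apply_of_ne_of_ne hil.symm hjl.symm
      rcases this with (rfl | rfl) | ⟨rfl, rfl⟩ | ⟨rfl, rfl⟩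
      · rw [hsl, ← mul_sub]; exact dvd_mul_right _ _
      · rw [hsl, ← sub_mul]; exact dvd_mul_left _ _
      · simp [mul_comm]
      · simp [mul_comm]
    have h2 : ((X 0 : MvPolynomial (Fin 3) F) ^ 2 + X 1 ^ 2 + X 2 ^ 2) = ∑ i, X i ^ 2 := by
      rw [Fin.sum_univ_three]
    rcases hg with rfl | rfl | rfl | rfl
    · simpa using h1 1 2 (by decide)
    · simpa using h1 0 2 (by decide)
    · simpa using h1 0 1 (by decide)
    · rw [h2]
      have : (∑ a, X (Equiv.swap i j a) ^ 2 : MvPolynomial (Fin 3) F) = ∑ a, X a ^ 2 :=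
        Equiv.sum_comp (Equiv.swap i j) fun a => (X a : MvPolynomial (Fin 3) F) ^ 2
      simp [this]

theorem expVec_mapDomain_swap_zero_one (a b c : ℕ) :
    (expVec a b c).mapDomain (Equiv.swap 0 1) = expVec b a c := by
  rw [← Finsupp.equivMapDomain_eq_mapDomain]
  ext i
  fin_cases i <;> rfl

theorem expVec_mapDomain_swap_zero_two (a b c : ℕ) :
    (expVec a b c).mapDomain (Equiv.swap 0 2) = expVec c b a := by
  rw [← Finsupp.equivMapDomain_eq_mapDomain]
  ext i
  fin_cases i <;> rfl

theorem expVec_mapDomain_swap_one_two (a b c : ℕ) :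
    (expVec a b c).mapDomain (Equiv.swap 1 2) = expVec a c b := by
  rw [← Finsupp.equivMapDomain_eq_mapDomain]
  ext i
  fin_cases i <;> rfl

/-- The independence half. Below degree 2s the coefficients vanish since J^s ⊆ m^(2s); in degree 2s
a suitable swap carries each standard exponent to a nonstandard one, where the coefficient is zero.
-/
theorem eq_zero_of_mem_symmIdeal_pow {s : ℕ} {p : MvPolynomial (Fin 3) F}
    (hp : p ∈ symmIdeal F ^ s) (hsupp : ∀ e, coeff e p ≠ 0 → IsStandardExp s e) : p = 0 := by
  have h01 (a b : ℕ) (h : a + b = 2 * s) :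
      coeff (expVec b a 0) p = coeff (expVec a b 0) p := by
    rw [← expVec_mapDomain_swap_zero_one]
    exact coeff_mapDomain_swap_of_mem hp 0 1 2 (by decide) (by decide) (by decide) _
      (by simpa using h) rfl
  have h02 (a b : ℕ) (h : a + b = 2 * s) :
      coeff (expVec b 0 a) p = coeff (expVec a 0 b) p := by
    rw [← expVec_mapDomain_swap_zero_two]
    exact coeff_mapDomain_swap_of_mem hp 0 2 1 (by decide) (by decide) (by decide) _
      (by simpa using h) rfl
  have h12 (a b : ℕ) (h : a + b = 2 * s) :
      coeff (expVec 0 b a) p = coeff (expVec 0 a b) p := by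
    rw [← expVec_mapDomain_swap_one_two]
    exact coeff_mapDomain_swap_of_mem hp 1 2 0 (by decide) (by decide) (by decide) _
      (by simpa using h) rfl
  have hz (a b c : ℕ) (h : ¬ IsStandardExp s (expVec a b c)) : coeff (expVec a b c) p = 0 := by
    by_contra hne
    exact h (hsupp _ hne)
  simp only [IsStandardExp, expVec_degree, expVec_zero, expVec_one, expVec_two] at hz
  ext e
  rw [coeff_zero]
  by_contra hne
  have hstd := hsupp e hne
  rcases hstd with hlt | ⟨hdeg, hstd⟩
  · refine hne ((mem_pow_idealOfVars_iff' _ _).1 ?_ e hlt)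
    rw [pow_mul]
    exact Ideal.pow_right_mono symmIdeal_le s hp
  · rw [← expVec_eta e] at hne hdeg
    simp only [expVec_degree] at hdeg
    generalize e 0 = a, e 1 = b, e 2 = c at hne hdeg hstd
    rcases hstd with ⟨rfl, h⟩ | ⟨rfl, h⟩ | ⟨rfl, h, h'⟩
    · exact hne ((h01 b a (by lia)).trans (hz _ _ _ (by lia)))
    -- For z^(2s) the swap with y is useless, as y^(2s) is standard too; the swap with x leads to
    -- the nonstandard x^(2s).
    · rcases Nat.eq_zero_or_pos b with rfl | hb
      · exact hne ((h02 c 0 (by lia)).trans (hz _ _ _ (by lia)))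
      · exact hne ((h12 c b (by lia)).trans (hz _ _ _ (by lia)))
    · exact hne ((h02 c a (by lia)).trans (hz _ _ _ (by lia)))

theorem finrank_quotient_symmIdeal_pow {s : ℕ} (hs : 0 < s) :
    Module.finrank F (MvPolynomial (Fin 3) F ⧸ symmIdeal F ^ s) + 1 =
      (2 * s + 2).choose 3 + 3 * s := by
  obtain ⟨T, hT, hcard⟩ := exists_finset_isStandardExp hs
  let v : T → MvPolynomial (Fin 3) F ⧸ symmIdeal F ^ s :=
    fun e => Ideal.Quotient.mkₐ F _ (monomial e.1 1)
  have hli : LinearIndependent F v := by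
    rw [Fintype.linearIndependent_iff]
    intro d hd
    let p : MvPolynomial (Fin 3) F := ∑ e : T, monomial e.1 (d e)
    have hp : p ∈ symmIdeal F ^ s := by
      rw [← Ideal.Quotient.eq_zero_iff_mem, ← Ideal.Quotient.mkₐ_eq_mk F, map_sum, ← hd]
      refine Finset.sum_congr rfl fun e _ => ?_
      rw [← map_smul, smul_monomial, smul_eq_mul, mul_one]
    have hcoeff (e : T) : coeff e.1 p = d e := by
      classical
      simp [p, coeff_sum, coeff_monomial]
    have hp0 : p = 0 := by
      refine eq_zero_of_mem_symmIdeal_pow hp fun e he => ?_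
      by_contra hstd
      refine he ?_
      classical
      rw [coeff_sum]
      refine Finset.sum_eq_zero fun i _ => ?_
      rw [coeff_monomial, if_neg]
      rintro rfl
      exact hstd ((hT _).1 i.2)
    intro e
    rw [← hcoeff, hp0, coeff_zero]
  have hspan : ⊤ ≤ Submodule.span F (Set.range v) := by
    rintro q -
    obtain ⟨p, rfl⟩ := Ideal.Quotient.mkₐ_surjective F _ q
    change p ∈ (Submodule.span F (Set.range v)).comap (Ideal.Quotient.mkₐ F _).toLinearMap
    rw [p.as_sum]
    refine Submodule.sum_mem _ fun e _ => ?_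
    rw [← mul_one (coeff e p), ← smul_eq_mul, ← smul_monomial]
    refine Submodule.smul_mem _ _ ?_
    refine SetLike.le_def.1 (sup_le ?_ ?_) (monomial_mem_symmIdeal_pow_sup s e)
    · intro r hr
      have : Ideal.Quotient.mkₐ F (symmIdeal F ^ s) r = 0 := Ideal.Quotient.eq_zero_iff_mem.2 hr
      simp [this]
    · rw [Submodule.span_le]
      rintro _ ⟨e, he, rfl⟩
      exact Submodule.subset_span ⟨⟨e, (hT e).2 he⟩, rfl⟩
  rw [Module.finrank_eq_card_basis (Module.Basis.mk hli hspan), Fintype.card_coe, hcard]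

end

/-! ### Length and vector space dimension -/

section Length

variable {K : Type*} [Field K]

theorem exists_sub_algebraMap_mem_nilradical {σ : Type*} {I : Ideal (MvPolynomial σ K)}
    (hnil : ∀ i, IsNilpotent (Ideal.Quotient.mk I (X i))) (a : MvPolynomial σ K ⧸ I) :
    ∃ c : K, a - algebraMap K _ c ∈ nilradical (MvPolynomial σ K ⧸ I) := by
  obtain ⟨p, rfl⟩ := Ideal.Quotient.mk_surjective a
  induction p using MvPolynomial.induction_on with
  | C c =>
    refine ⟨c, ?_⟩
    rw [← Ideal.Quotient.mk_algebraMap, algebraMap_eq, sub_self]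
    exact zero_mem _
  | add p q hp hq =>
    obtain ⟨c, hc⟩ := hp
    obtain ⟨d, hd⟩ := hq
    refine ⟨c + d, ?_⟩
    convert add_mem hc hd using 1
    rw [map_add, map_add]; ring
  | mul_X p i _ =>
    refine ⟨0, ?_⟩
    rw [map_zero, sub_zero, map_mul]
    exact Ideal.mul_mem_left _ _ (hnil i)

/-- Every element is a scalar plus a nilpotent, so the ring is local with residue field K, and
restricting scalars to K multiplies the length by one. -/
theorem length_eq_finrank_of_nilpotent {A : Type*} [CommRing A] [Algebra K A] [Nontrivial A]
    [Module.Finite K A] (h : ∀ a : A, ∃ c : K, a - algebraMap K A c ∈ nilradical A) :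
    Module.length A A = Module.finrank K A := by
  have : IsLocalRing A := by
    refine IsLocalRing.of_isUnit_or_isUnit_one_sub_self fun a => ?_
    obtain ⟨c, hc⟩ := h a
    rcases eq_or_ne c 0 with rfl | hc0
    · rw [map_zero, sub_zero] at hc
      exact Or.inr (IsNilpotent.isUnit_one_sub hc)
    · left
      have := IsNilpotent.isUnit_add_left_of_commute (mem_nilradical.1 hc)
        ((isUnit_iff_ne_zero.2 hc0).map (algebraMap K A)) (Commute.all _ _)
      simpa using this
  have : IsLocalHom (algebraMap K A) := ⟨fun a ha => by
    rw [isUnit_iff_ne_zero]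
    rintro rfl
    simp at ha⟩
  have hsurj : Function.Surjective
      (algebraMap (IsLocalRing.ResidueField K) (IsLocalRing.ResidueField A)) := by
    intro r
    obtain ⟨a, rfl⟩ := IsLocalRing.residue_surjective r
    obtain ⟨c, hc⟩ := h a
    refine ⟨IsLocalRing.residue K c, ?_⟩
    change IsLocalRing.residue A (algebraMap K A c) = _
    rw [eq_comm, ← sub_eq_zero, ← map_sub, IsLocalRing.residue_eq_zero_iff]
    exact nilradical_le_prime _ hc
  have h1 := IsLocalRing.length_restrictScalars K A A
  rw [Module.length_eq_of_surjective (M := IsLocalRing.ResidueField A) hsurj,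
    Module.length_eq_one (IsLocalRing.ResidueField A) (IsLocalRing.ResidueField A), mul_one,
    Module.length_eq_finrank] at h1
  exact h1.symm

theorem length_quotient_eq_finrank {σ : Type*} {I : Ideal (MvPolynomial σ K)}
    (hnil : ∀ i, IsNilpotent (Ideal.Quotient.mk I (X i)))
    (hpos : 0 < Module.finrank K (MvPolynomial σ K ⧸ I)) :
    Module.length (MvPolynomial σ K) (MvPolynomial σ K ⧸ I) =
      Module.finrank K (MvPolynomial σ K ⧸ I) := by
  have : Nontrivial (MvPolynomial σ K ⧸ I) := Module.nontrivial_of_finrank_pos hpos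
  have : Module.Finite K (MvPolynomial σ K ⧸ I) := Module.finite_of_finrank_pos hpos
  rw [Module.length_eq_of_surjective (R := MvPolynomial σ K ⧸ I) Ideal.Quotient.mk_surjective]
  exact length_eq_finrank_of_nilpotent (exists_sub_algebraMap_mem_nilradical hnil)

end Length

/-! ### Extension of the base field -/

section BaseChange

open TensorProduct

variable {K : Type*} (L : Type*) [Field K] [Field L] [Algebra K L] {σ : Type*}
  (I : Ideal (MvPolynomial σ K))

theorem map_map_includeRight :
    I.map (map (algebraMap K L)) =
      (I.map (Algebra.TensorProduct.includeRight (R := K) (A := L))).map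
        (algebraTensorAlgEquiv (σ := σ) K L : L ⊗[K] MvPolynomial σ K →+* MvPolynomial σ L) := by
  refine le_antisymm (Ideal.map_le_iff_le_comap.2 fun p hp => ?_)
    (Ideal.map_le_iff_le_comap.2 (Ideal.map_le_iff_le_comap.2 fun p hp => ?_))
  · have h := Ideal.mem_map_of_mem
      (algebraTensorAlgEquiv (σ := σ) K L : L ⊗[K] MvPolynomial σ K →+* MvPolynomial σ L)
      (Ideal.mem_map_of_mem (Algebra.TensorProduct.includeRight (R := K) (A := L)) hp)
    simpa using h
  · simpa using Ideal.mem_map_of_mem (map (algebraMap K L)) hp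

/-- The base change of a quotient of a polynomial ring over `K` to an extension `L` of `K`. -/
noncomputable def tensorQuotientEquivQuotientMap :
    L ⊗[K] (MvPolynomial σ K ⧸ I) ≃ₐ[L] MvPolynomial σ L ⧸ I.map (map (algebraMap K L)) :=
  (Algebra.TensorProduct.tensorQuotientEquiv (R := K) L (MvPolynomial σ K) L I).trans <|
    Ideal.quotientEquivAlg _ _ (algebraTensorAlgEquiv K L) (map_map_includeRight L I)

theorem finrank_quotient_map :
    Module.finrank L (MvPolynomial σ L ⧸ I.map (map (algebraMap K L))) =
      Module.finrank K (MvPolynomial σ K ⧸ I) := by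
  rw [← (tensorQuotientEquivQuotientMap L I).toLinearEquiv.finrank_eq, Module.finrank_baseChange]

/-- The quotient over `K` embeds into its base change, so nilpotency descends. -/
theorem isNilpotent_mk_X_of_map (i : σ)
    (h : IsNilpotent (Ideal.Quotient.mk (I.map (map (algebraMap K L))) (X i))) :
    IsNilpotent (Ideal.Quotient.mk I (X i)) := by
  obtain ⟨n, hn⟩ := h
  refine ⟨n, ?_⟩
  apply Algebra.TensorProduct.includeRight_injective (R := K) (A := L)
    (algebraMap K L).injective
  apply (tensorQuotientEquivQuotientMap L I).injective
  rw [map_zero, map_zero, ← hn, map_pow, map_pow]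
  congr 1
  change Ideal.Quotient.mk _ (algebraTensorAlgEquiv K L (1 ⊗ₜ X i)) = _
  simp

end BaseChange

/-! ### Pencils of symmetric 3×3 matrices -/

section Pencil

open Matrix

/-- The cubic polynomial `det (t A - B)` in `t`. -/
def pencilCubic {R : Type*} [CommRing R] (A B : Matrix (Fin 3) (Fin 3) R) : Cubic R :=
  ⟨A.det, -(A.adjugate * B).trace, (B.adjugate * A).trace, -B.det⟩

theorem eval_pencilCubic {R : Type*} [CommRing R] (A B : Matrix (Fin 3) (Fin 3) R) (t : R) :
    (pencilCubic A B).toPoly.eval t = (t • A - B).det := by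
  simp only [pencilCubic, Cubic.toPoly, Polynomial.eval_add, Polynomial.eval_mul,
    Polynomial.eval_C, Polynomial.eval_pow, Polynomial.eval_X, det_fin_three, adjugate_fin_three,
    trace_fin_three, mul_apply, Fin.sum_univ_three, of_apply, cons_val', cons_val_zero,
    cons_val_one, cons_val, cons_val_fin_one, Matrix.sub_apply, Matrix.smul_apply,
    smul_eq_mul]
  ring

theorem pencilCubic_map {R S : Type*} [CommRing R] [CommRing S] (φ : R →+* S)
    (A B : Matrix (Fin 3) (Fin 3) R) :
    pencilCubic (A.map φ) (B.map φ) = (pencilCubic A B).map φ := by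
  have hA := φ.map_adjugate A
  have hB := φ.map_adjugate B
  simp only [RingHom.mapMatrix_apply] at hA hB
  simp only [pencilCubic, Cubic.map, map_neg, ← hA, ← hB, ← Matrix.map_mul, RingHom.map_det,
    RingHom.mapMatrix_apply]
  simp [trace_fin_three, mul_apply, Fin.sum_univ_three]

theorem discr_map {R S : Type*} [CommRing R] [CommRing S] (φ : R →+* S) (P : Cubic R) :
    (P.map φ).discr = φ P.discr := by
  simp only [Cubic.discr, Cubic.map, map_add, map_sub, map_mul, map_pow, map_ofNat]

variable {F : Type*} [Field F] [IsAlgClosed F]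

/-- Each root of `det (t A - B)` gives a kernel vector, which is an eigenvector of `A⁻¹ * B`;
distinct eigenvalues make the three vectors independent. -/
theorem exists_generalized_eigenvectors {A B : Matrix (Fin 3) (Fin 3) F} (hA : A.det ≠ 0)
    (hdisc : (pencilCubic A B).discr ≠ 0) :
    ∃ (μ : Fin 3 → F) (V : Matrix (Fin 3) (Fin 3) F), Function.Injective μ ∧ V.det ≠ 0 ∧
      ∀ i, B *ᵥ V i = μ i • A *ᵥ V i := by
  have ha : (pencilCubic A B).a ≠ 0 := hA
  obtain ⟨x, y, z, h3⟩ := (Cubic.splits_iff_roots_eq_three (φ := RingHom.id F) ha).1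
    (IsAlgClosed.splits _)
  obtain ⟨hxy, hxz, hyz⟩ := (Cubic.discr_ne_zero_iff_roots_ne ha h3).1 hdisc
  have hroot (t : F) (ht : t ∈ ({x, y, z} : Multiset F)) :
      ∃ v, v ≠ 0 ∧ B *ᵥ v = t • A *ᵥ v := by
    rw [← h3, Cubic.map_roots, Polynomial.map_id] at ht
    have h := Polynomial.isRoot_of_mem_roots ht
    rw [Polynomial.IsRoot, eval_pencilCubic] at h
    obtain ⟨v, hv, hv'⟩ := exists_mulVec_eq_zero_iff.2 h
    refine ⟨v, hv, ?_⟩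
    rw [sub_mulVec, smul_mulVec, sub_eq_zero] at hv'
    exact hv'.symm
  let μ : Fin 3 → F := ![x, y, z]
  have hμ : Function.Injective μ := by
    intro i j
    fin_cases i <;> fin_cases j <;> simp [μ, hxy, hxz, hyz, hxy.symm, hxz.symm, hyz.symm]
  choose v hv hBv using fun i => hroot (μ i) (by fin_cases i <;> simp [μ])
  refine ⟨μ, v, hμ, ?_, hBv⟩
  have hAu : IsUnit A.det := isUnit_iff_ne_zero.2 hA
  have hli := Module.End.eigenvectors_linearIndependent' (toLin' (A⁻¹ * B)) μ hμ v fun i => by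
    refine ⟨Module.End.mem_eigenspace_iff.2 ?_, hv i⟩
    rw [toLin'_apply, ← mulVec_mulVec, hBv, mulVec_smul, mulVec_mulVec, nonsing_inv_mul _ hAu,
      one_mulVec]
  have := (linearIndependent_rows_iff_isUnit (A := (v : Matrix (Fin 3) (Fin 3) F))).1 hli
  exact ((isUnit_iff_isUnit_det _).1 this).ne_zero

/-- By symmetry, generalized eigenvectors with different eigenvalues are orthogonal for both forms.
Rescaling them by square roots then prescribes any nonzero diagonal for `A`. -/
theorem exists_simultaneous_diagonalization {A B : Matrix (Fin 3) (Fin 3) F} (hAs : A.IsSymm)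
    (hBs : B.IsSymm) (hA : A.det ≠ 0) (hdisc : (pencilCubic A B).discr ≠ 0) :
    ∃ V : Matrix (Fin 3) (Fin 3) F, V.det ≠ 0 ∧
      (∀ i j, i ≠ j → (V * A * Vᵀ) i j = 0 ∧ (V * B * Vᵀ) i j = 0) ∧
      (V * A * Vᵀ).trace = 0 ∧ (V * B * Vᵀ).trace = 0 := by
  obtain ⟨μ, V, hμ, hV, hBV⟩ := exists_generalized_eigenvectors hA hdisc
  have happ (M V : Matrix (Fin 3) (Fin 3) F) (i j : Fin 3) :
      (V * M * Vᵀ) i j = V i ⬝ᵥ (M *ᵥ V j) := by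
    rw [Matrix.mul_assoc, mul_apply, dotProduct]
    rfl
  have hsymm {M : Matrix (Fin 3) (Fin 3) F} (hM : M.IsSymm) (v w : Fin 3 → F) :
      v ⬝ᵥ (M *ᵥ w) = w ⬝ᵥ (M *ᵥ v) := by
    rw [dotProduct_mulVec, dotProduct_comm, ← mulVec_transpose, hM.eq]
  have hB (i j) : V i ⬝ᵥ (B *ᵥ V j) = μ j * (V i ⬝ᵥ (A *ᵥ V j)) := by
    rw [hBV, dotProduct_smul, smul_eq_mul]
  have hA0 (i j) (hij : i ≠ j) : V i ⬝ᵥ (A *ᵥ V j) = 0 := by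
    have h1 := hB i j
    rw [hsymm hBs, hB j i, hsymm hAs] at h1
    have h2 : (μ i - μ j) * (V i ⬝ᵥ (A *ᵥ V j)) = 0 := by rw [sub_mul, h1, sub_self]
    exact (mul_eq_zero.1 h2).resolve_left (sub_ne_zero.2 (hμ.ne hij))
  let α : Fin 3 → F := fun i => V i ⬝ᵥ (A *ᵥ V i)
  have hα (i) : α i ≠ 0 := by
    have h1 : V * A * Vᵀ = diagonal α := by
      ext i j
      rw [happ, diagonal_apply]
      split_ifs with h
      · rw [h]
      · exact hA0 i j h
    have h2 := congrArg det h1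
    rw [det_mul, det_mul, det_transpose, det_diagonal] at h2
    have h3 : ∏ i, α i ≠ 0 := by
      rw [← h2]
      exact mul_ne_zero (mul_ne_zero hV hA) hV
    exact (Finset.prod_ne_zero_iff.1 h3) i (Finset.mem_univ i)
  -- The cross product of (1, 1, 1) and μ: both ∑ ν i and ∑ μ i * ν i vanish, and these are the two
  -- traces after rescaling. Distinct eigenvalues make every entry nonzero.
  let ν : Fin 3 → F := ![μ 1 - μ 2, μ 2 - μ 0, μ 0 - μ 1]
  have hν (i) : ν i ≠ 0 := by
    fin_cases i <;> exact sub_ne_zero.2 (hμ.ne (by decide))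
  choose r hr using fun i => IsAlgClosed.exists_pow_nat_eq (ν i / α i) two_pos
  have hrα (i) : r i ^ 2 * α i = ν i := by rw [hr, div_mul_cancel₀ _ (hα i)]
  have hr0 (i) : r i ≠ 0 := by
    intro h
    refine hν i ?_
    rw [← hrα, h]
    simp
  have hrow (i) : (diagonal r * V) i = r i • V i := by
    ext j
    simp [diagonal_mul]
  have happ' (M : Matrix (Fin 3) (Fin 3) F) (i j : Fin 3) :
      (diagonal r * V * M * (diagonal r * V)ᵀ) i j = r i * r j * (V i ⬝ᵥ (M *ᵥ V j)) := by
    rw [happ, hrow, hrow, mulVec_smul, dotProduct_smul, smul_dotProduct]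
    simp only [smul_eq_mul]
    ring
  refine ⟨diagonal r * V, ?_, fun i j hij => ⟨?_, ?_⟩, ?_, ?_⟩
  · rw [det_mul, det_diagonal]
    exact mul_ne_zero (Finset.prod_ne_zero_iff.2 fun i _ => hr0 i) hV
  · rw [happ', hA0 i j hij, mul_zero]
  · rw [happ', hB, hA0 i j hij, mul_zero, mul_zero]
  · have hd (i : Fin 3) : (diagonal r * V * A * (diagonal r * V)ᵀ) i i = ν i := by
      rw [happ', ← pow_two, ← hrα]
    rw [trace_fin_three, hd, hd, hd]
    simp [ν]
  · have hd (i : Fin 3) : (diagonal r * V * B * (diagonal r * V)ᵀ) i i = μ i * ν i := by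
      rw [happ', hB, ← pow_two, ← hrα]
      ring
    rw [trace_fin_three, hd, hd, hd]
    simp only [ν, cons_val_zero, cons_val_one, cons_val]
    ring

end Pencil

/-! ### Linear changes of coordinates -/

section LinSubst

variable {F : Type*} [Field F]

/-- The linear substitution `X i ↦ ∑ j, V i j * X j`. -/
noncomputable def linSubst {n : ℕ} (V : Matrix (Fin n) (Fin n) F) :
    MvPolynomial (Fin n) F →ₐ[F] MvPolynomial (Fin n) F :=
  aeval fun i => ∑ j, V i j • X j

theorem linSubst_X {n : ℕ} (V : Matrix (Fin n) (Fin n) F) (i : Fin n) :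
    linSubst V (X i) = ∑ j, V i j • X j := by
  simp [linSubst]

theorem linSubst_comp {n : ℕ} (V W : Matrix (Fin n) (Fin n) F) :
    (linSubst V).comp (linSubst W) = linSubst (W * V) := by
  ext1 i
  simp only [AlgHom.comp_apply, linSubst_X, map_sum, map_smul, Matrix.mul_apply, Finset.sum_smul,
    Finset.smul_sum, smul_smul]
  exact Finset.sum_comm

theorem linSubst_one {n : ℕ} : linSubst (1 : Matrix (Fin n) (Fin n) F) = AlgHom.id F _ := by
  ext1 i
  simp [linSubst_X, Matrix.one_apply]

/-- The linear change of coordinates given by an invertible matrix. -/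
noncomputable def linSubstEquiv {n : ℕ} (V : Matrix (Fin n) (Fin n) F) (hV : IsUnit V.det) :
    MvPolynomial (Fin n) F ≃ₐ[F] MvPolynomial (Fin n) F :=
  AlgEquiv.ofAlgHom (linSubst V) (linSubst V⁻¹)
    (by rw [linSubst_comp, Matrix.nonsing_inv_mul _ hV, linSubst_one])
    (by rw [linSubst_comp, Matrix.mul_nonsing_inv _ hV, linSubst_one])

end LinSubst

/-! ### The pencil annihilating four quadrics, and the genericity polynomial -/

section General

open Matrix

/-- The monomials `xz`, `yz`, `z²`, `y²`. -/
noncomputable def mainMonomial : Fin 4 → QuadMonomial 3 :=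
  ![⟨expVec 1 0 1, by simp⟩, ⟨expVec 0 1 1, by simp⟩, ⟨expVec 0 0 2, by simp⟩,
    ⟨expVec 0 2 0, by simp⟩]

/-- The monomials `x²`, `xy`. -/
noncomputable def restMonomial : Fin 2 → QuadMonomial 3 :=
  ![⟨expVec 2 0 0, by simp⟩, ⟨expVec 1 1 0, by simp⟩]

theorem quadMonomial_cases {P : (Fin 3 →₀ ℕ) → Prop} (hmain : ∀ i, P (mainMonomial i).1)
    (hrest : ∀ a, P (restMonomial a).1) (e : Fin 3 →₀ ℕ) (he : e.degree = 2) : P e := by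
  rw [← expVec_eta e] at he ⊢
  generalize e 0 = a, e 1 = b, e 2 = c at he
  rw [expVec_degree] at he
  have : (a = 1 ∧ b = 0 ∧ c = 1) ∨ (a = 0 ∧ b = 1 ∧ c = 1) ∨ (a = 0 ∧ b = 0 ∧ c = 2) ∨
    (a = 0 ∧ b = 2 ∧ c = 0) ∨ (a = 2 ∧ b = 0 ∧ c = 0) ∨ (a = 1 ∧ b = 1 ∧ c = 0) := by lia
  rcases this with ⟨rfl, rfl, rfl⟩ | ⟨rfl, rfl, rfl⟩ | ⟨rfl, rfl, rfl⟩ | ⟨rfl, rfl, rfl⟩ |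
    ⟨rfl, rfl, rfl⟩ | ⟨rfl, rfl, rfl⟩
  · exact hmain 0
  · exact hmain 1
  · exact hmain 2
  · exact hmain 3
  · exact hrest 0
  · exact hrest 1

section Ring

variable {R : Type*} [CommRing R] (c : Fin 4 × QuadMonomial 3 → R)

/-- The coefficients at `xz`, `yz`, `z²`, `y²` of four quadratic forms. -/
noncomputable def mainCoeffs : Matrix (Fin 4) (Fin 4) R := of fun j i => c (j, mainMonomial i)

/-- The coefficients at `x²`, `xy` of four quadratic forms. -/
noncomputable def restCoeffs : Matrix (Fin 4) (Fin 2) R := of fun j a => c (j, restMonomial a)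

/-- The values at `xz`, `yz`, `z²`, `y²` of the two functionals annihilating the four forms with
coefficients `c` that take the values `det (mainCoeffs c), 0` and `0, det (mainCoeffs c)` at
`x²`, `xy`. -/
noncomputable def annihilator : Matrix (Fin 4) (Fin 2) R :=
  -((mainCoeffs c).adjugate * restCoeffs c)

/-- The two functionals of `annihilator` as symmetric matrices. -/
noncomputable def annihilatorForm (a : Fin 2) : Matrix (Fin 3) (Fin 3) R :=
  let d := fun b => if a = b then (mainCoeffs c).det else 0
  let w := fun i => annihilator c i a
  !![d 0, d 1, w 0; d 1, w 3, w 1; w 0, w 1, w 2]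

/-- The polynomial in the coefficients of four quadratic forms whose zeros are to be avoided. -/
noncomputable def genericityPoly : R :=
  (mainCoeffs c).det * ((annihilatorForm c 0).det *
    (pencilCubic (annihilatorForm c 0) (annihilatorForm c 1)).discr)

theorem annihilatorForm_isSymm (a : Fin 2) : (annihilatorForm c a).IsSymm := by
  ext i j
  fin_cases i <;> fin_cases j <;> rfl

variable {S : Type*} [CommRing S] (φ : R →+* S)

theorem annihilatorForm_map (a : Fin 2) :
    annihilatorForm (φ ∘ c) a = (annihilatorForm c a).map φ := by
  have hN : mainCoeffs (φ ∘ c) = (mainCoeffs c).map φ := rfl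
  have hM : restCoeffs (φ ∘ c) = (restCoeffs c).map φ := rfl
  have hW : annihilator (φ ∘ c) = (annihilator c).map φ := by
    have h := φ.map_adjugate (mainCoeffs c)
    rw [RingHom.mapMatrix_apply, RingHom.mapMatrix_apply] at h
    rw [annihilator, annihilator, hN, hM, ← h, ← Matrix.map_mul]
    ext i j
    exact (map_neg φ _).symm
  have hD : (mainCoeffs (φ ∘ c)).det = φ (mainCoeffs c).det := by
    rw [hN, RingHom.map_det, RingHom.mapMatrix_apply]
  ext i j
  fin_cases i <;> fin_cases j <;>
    simp [annihilatorForm, hD, hW, apply_ite φ]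

/-- Naturality lets one expression serve as a polynomial in indeterminate coefficients over `k` and
as its value over any extension. -/
theorem genericityPoly_map : genericityPoly (φ ∘ c) = φ (genericityPoly c) := by
  have hN : mainCoeffs (φ ∘ c) = (mainCoeffs c).map φ := rfl
  simp only [genericityPoly, annihilatorForm_map, pencilCubic_map, discr_map, map_mul,
    RingHom.map_det, RingHom.mapMatrix_apply, hN]

end Ring

section Field

variable {F : Type*} [Field F]

/-- The functional on polynomials given by `annihilatorForm`. -/
noncomputable def annihilatorFunctional (c : Fin 4 × QuadMonomial 3 → F) (a : Fin 2) :
    MvPolynomial (Fin 3) F →ₗ[F] F :=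
  ∑ i, annihilator c i a • lcoeff F (mainMonomial i).1 +
    (mainCoeffs c).det • lcoeff F (restMonomial a).1

theorem annihilatorFunctional_apply (c : Fin 4 × QuadMonomial 3 → F) (a : Fin 2)
    (p : MvPolynomial (Fin 3) F) : annihilatorFunctional c a p =
      ∑ i, annihilator c i a * coeff (mainMonomial i).1 p +
        (mainCoeffs c).det * coeff (restMonomial a).1 p := by
  simp [annihilatorFunctional]

theorem annihilatorFunctional_X_mul_X (c : Fin 4 × QuadMonomial 3 → F) (a : Fin 2)
    (i j : Fin 3) : annihilatorFunctional c a (X i * X j) = annihilatorForm c a i j := by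
  classical
  have hX : (X i * X j : MvPolynomial (Fin 3) F) =
      monomial (Finsupp.single i 1 + Finsupp.single j 1) 1 := by
    rw [X, X, monomial_mul, one_mul]
  have hs : ∀ i j : Fin 3, (Finsupp.single i 1 + Finsupp.single j 1 : Fin 3 →₀ ℕ) =
      expVec ((if i = 0 then 1 else 0) + if j = 0 then 1 else 0)
        ((if i = 1 then 1 else 0) + if j = 1 then 1 else 0)
        ((if i = 2 then 1 else 0) + if j = 2 then 1 else 0) := by
    intro i j
    ext l
    fin_cases l <;> simp [Finsupp.single_apply]
  rw [annihilatorFunctional_apply, hX, hs, Fin.sum_univ_four]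
  fin_cases a <;> fin_cases i <;> fin_cases j <;>
    simp [coeff_monomial, mainMonomial, restMonomial, expVec_inj, annihilatorForm]

/-- Substitution acts on the pencil by congruence, so finding good coordinates becomes a matrix
problem. -/
theorem annihilatorFunctional_linSubst (c : Fin 4 × QuadMonomial 3 → F) (a : Fin 2)
    (V : Matrix (Fin 3) (Fin 3) F) (i j : Fin 3) :
    annihilatorFunctional c a (linSubst V (X i * X j)) = (V * annihilatorForm c a * Vᵀ) i j := by
  rw [map_mul, linSubst_X, linSubst_X, Finset.sum_mul_sum, map_sum]
  simp only [map_sum, smul_mul_smul_comm, map_smul, annihilatorFunctional_X_mul_X, mul_apply,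
    Finset.sum_mul, transpose_apply, smul_eq_mul]
  rw [Finset.sum_comm]
  refine Finset.sum_congr rfl fun q _ => Finset.sum_congr rfl fun p _ => ?_
  ring

/-- Cramer's rule gives the combination of the forms that agrees with g at xz, yz, z², y². Vanishing
of the two functionals is exactly agreement at x² and xy. -/
theorem mem_span_of_annihilatorFunctional_eq_zero {f : Fin 4 → MvPolynomial (Fin 3) F}
    (hf : ∀ j, (f j).IsHomogeneous 2) (hD : (mainCoeffs (quadCoeffs f)).det ≠ 0)
    {g : MvPolynomial (Fin 3) F} (hg : g.IsHomogeneous 2)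
    (h : ∀ a, annihilatorFunctional (quadCoeffs f) a g = 0) :
    g ∈ Submodule.span F (Set.range f) := by
  set N := mainCoeffs (quadCoeffs f) with hN
  set M := restCoeffs (quadCoeffs f) with hM
  let g' : Fin 4 → F := fun i => coeff (mainMonomial i).1 g
  let β : Fin 4 → F := N.det⁻¹ • (g' ᵥ* N.adjugate)
  have hβN (i) : ∑ j, β j * coeff (mainMonomial i).1 (f j) = g' i := by
    change (β ᵥ* N) i = g' i
    rw [smul_vecMul, vecMul_vecMul, adjugate_mul, vecMul_smul, smul_smul, inv_mul_cancel₀ hD,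
      one_smul, vecMul_one]
  have hβM (a) : ∑ j, β j * coeff (restMonomial a).1 (f j) = coeff (restMonomial a).1 g := by
    change (β ᵥ* M) a = _
    have h1 : ∑ i, annihilator (quadCoeffs f) i a * g' i = -(g' ᵥ* (N.adjugate * M)) a := by
      rw [annihilator, vecMul, dotProduct, ← Finset.sum_neg_distrib]
      refine Finset.sum_congr rfl fun i _ => ?_
      simp only [Matrix.neg_apply, ← hN, ← hM]
      ring
    have h2 := h a
    rw [annihilatorFunctional_apply, h1, neg_add_eq_zero] at h2
    rw [smul_vecMul, vecMul_vecMul, Pi.smul_apply, h2, smul_eq_mul, inv_mul_cancel_left₀ hD]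
  have hsum : g = ∑ j, β j • f j := by
    ext e
    rw [coeff_sum]
    simp only [coeff_smul, smul_eq_mul]
    by_cases he : e.degree = 2
    · refine quadMonomial_cases (P := fun e => coeff e g = ∑ j, β j * coeff e (f j))
        (fun i => (hβN i).symm) (fun a => (hβM a).symm) e he
    · rw [hg.coeff_eq_zero he, Finset.sum_eq_zero]
      intro j _
      rw [(hf j).coeff_eq_zero he, mul_zero]
  rw [hsum]
  exact Submodule.sum_mem _ fun j _ => Submodule.smul_mem _ _ (Submodule.subset_span ⟨j, rfl⟩)

/-- The generators of `symmIdeal`. -/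
noncomputable def symmGens (F : Type*) [Field F] : Fin 4 → MvPolynomial (Fin 3) F :=
  ![X 1 * X 2, X 0 * X 2, X 0 * X 1, X 0 * X 0 + X 1 * X 1 + X 2 * X 2]

theorem symmIdeal_eq_span_range : symmIdeal F = Ideal.span (Set.range (symmGens F)) := by
  rw [symmIdeal, symmGens]
  simp only [Matrix.range_cons, Matrix.range_empty, Set.union_empty, Set.singleton_union, pow_two]

theorem linearIndependent_symmGens : LinearIndependent F (symmGens F) := by
  rw [Fintype.linearIndependent_iff]
  intro d hd
  have h (a b c : ℕ) := congrArg (coeff (expVec a b c)) hd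
  have hX (i j : Fin 3) : (X i * X j : MvPolynomial (Fin 3) F) =
      X 0 ^ ((if i = 0 then 1 else 0) + if j = 0 then 1 else 0) *
      X 1 ^ ((if i = 1 then 1 else 0) + if j = 1 then 1 else 0) *
      X 2 ^ ((if i = 2 then 1 else 0) + if j = 2 then 1 else 0) := by
    fin_cases i <;> fin_cases j <;> simp <;> ring
  classical
  simp only [Fin.sum_univ_four, symmGens, Matrix.cons_val_zero, Matrix.cons_val_one,
    Matrix.cons_val, hX, ← monomial_expVec, coeff_add, coeff_smul, coeff_monomial, expVec_inj] at h
  intro i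
  fin_cases i
  · simpa using h 0 1 1
  · simpa using h 1 0 1
  · simpa using h 1 1 0
  · simpa using h 2 0 0

/-- In the diagonalizing coordinates, zero off-diagonal entries put the mixed products in the span
of the forms, and zero traces put the sum of squares there. -/
theorem exists_span_eq_map_symmIdeal [IsAlgClosed F] {f : Fin 4 → MvPolynomial (Fin 3) F}
    (hf : ∀ j, (f j).IsHomogeneous 2) (h : genericityPoly (quadCoeffs f) ≠ 0) :
    ∃ (V : Matrix (Fin 3) (Fin 3) F) (hV : IsUnit V.det),
      Ideal.span (Set.range f) = (symmIdeal F).map (linSubstEquiv V hV : _ →+* _) := by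
  obtain ⟨hD, h⟩ := mul_ne_zero_iff.1 h
  obtain ⟨hA, hdisc⟩ := mul_ne_zero_iff.1 h
  obtain ⟨V, hV, hoff, htr0, htr1⟩ := exists_simultaneous_diagonalization
    (annihilatorForm_isSymm _ 0) (annihilatorForm_isSymm _ 1) hA hdisc
  refine ⟨V, isUnit_iff_ne_zero.2 hV, ?_⟩
  set e := linSubstEquiv V (isUnit_iff_ne_zero.2 hV)
  have happ (p) : e p = linSubst V p := rfl
  have hhom (i j : Fin 3) : (linSubst V (X i * X j)).IsHomogeneous 2 := by
    have h1 (i : Fin 3) : (linSubst V (X i)).IsHomogeneous 1 := by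
      rw [linSubst_X]
      refine IsHomogeneous.sum _ _ _ fun j _ => ?_
      rw [smul_eq_C_mul]
      simpa using (isHomogeneous_C (Fin 3) (V i j)).mul (isHomogeneous_X F j)
    rw [map_mul]
    exact (h1 i).mul (h1 j)
  have hmem (i j : Fin 3) (hij : i ≠ j) :
      linSubst V (X i * X j) ∈ Submodule.span F (Set.range f) := by
    refine mem_span_of_annihilatorFunctional_eq_zero hf hD (hhom i j) fun a => ?_
    rw [annihilatorFunctional_linSubst]
    fin_cases a
    · exact (hoff i j hij).1
    · exact (hoff i j hij).2
  have hle : Submodule.span F (Set.range (e ∘ symmGens F)) ≤ Submodule.span F (Set.range f) := by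
    rw [Submodule.span_le]
    rintro _ ⟨i, rfl⟩
    rw [Function.comp_apply, happ]
    fin_cases i
    · exact hmem 1 2 (by decide)
    · exact hmem 0 2 (by decide)
    · exact hmem 0 1 (by decide)
    · change linSubst V (X 0 * X 0 + X 1 * X 1 + X 2 * X 2) ∈ _
      rw [map_add, map_add]
      refine mem_span_of_annihilatorFunctional_eq_zero hf hD
        (((hhom 0 0).add (hhom 1 1)).add (hhom 2 2)) fun a => ?_
      rw [map_add, map_add, annihilatorFunctional_linSubst, annihilatorFunctional_linSubst,
        annihilatorFunctional_linSubst, ← trace_fin_three]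
      fin_cases a
      · exact htr0
      · exact htr1
  have hli : LinearIndependent F (e ∘ symmGens F) :=
    linearIndependent_symmGens.map' e.toLinearMap (LinearMap.ker_eq_bot.2 e.injective)
  have : FiniteDimensional F (Submodule.span F (Set.range f)) :=
    FiniteDimensional.span_of_finite F (Set.finite_range f)
  -- Four independent elements lie in a space spanned by four, so the inclusion is an equality.
  have heq := Submodule.eq_of_le_of_finrank_le hle <| by
    rw [finrank_span_eq_card hli]
    exact finrank_range_le_card f
  have hspan (G : Fin 4 → MvPolynomial (Fin 3) F) : Ideal.span (Set.range G) =
      Ideal.span (Submodule.span F (Set.range G) : Set (MvPolynomial (Fin 3) F)) := by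
    rw [Ideal.span, Ideal.span, Submodule.span_span_of_tower]
  rw [hspan, ← heq, ← hspan, symmIdeal_eq_span_range, Ideal.map_span, ← Set.range_comp]
  rfl

theorem finrank_quotient_span_pow [IsAlgClosed F] {f : Fin 4 → MvPolynomial (Fin 3) F}
    (hf : ∀ j, (f j).IsHomogeneous 2) (h : genericityPoly (quadCoeffs f) ≠ 0) {s : ℕ}
    (hs : 0 < s) :
    Module.finrank F (MvPolynomial (Fin 3) F ⧸ Ideal.span (Set.range f) ^ s) + 1 =
        (2 * s + 2).choose 3 + 3 * s ∧
      ∀ i, IsNilpotent (Ideal.Quotient.mk (Ideal.span (Set.range f) ^ s) (X i)) := by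
  obtain ⟨V, hV, hI⟩ := exists_span_eq_map_symmIdeal hf h
  have hIs : Ideal.span (Set.range f) ^ s =
      (symmIdeal F ^ s).map (linSubstEquiv V hV : _ →+* _) := by
    rw [hI, Ideal.map_pow]
  let E := Ideal.quotientEquivAlg _ _ (linSubstEquiv V hV) hIs
  refine ⟨?_, fun i => ?_⟩
  · rw [← E.toLinearEquiv.finrank_eq, finrank_quotient_symmIdeal_pow hs]
  · have hX (j : Fin 3) : Ideal.Quotient.mk (symmIdeal F ^ s) (X j) ∈ nilradical _ := by
      refine mem_nilradical.2 ⟨2 * s + 1, ?_⟩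
      rw [← map_pow, Ideal.Quotient.eq_zero_iff_mem]
      fin_cases j
      · simpa using monomial_mem_symmIdeal_pow (F := F) (a := 2 * s + 1) (b := 0) (c := 0)
          (s := s) (by lia)
      · simpa using monomial_mem_symmIdeal_pow (F := F) (a := 0) (b := 2 * s + 1) (c := 0)
          (s := s) (by lia)
      · simpa using monomial_mem_symmIdeal_pow (F := F) (a := 0) (b := 0) (c := 2 * s + 1)
          (s := s) (by lia)
    have h1 : Ideal.Quotient.mk (symmIdeal F ^ s) ((linSubstEquiv V hV).symm (X i)) ∈
        nilradical _ := by
      change Ideal.Quotient.mk _ (linSubst V⁻¹ (X i)) ∈ _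
      rw [linSubst_X, map_sum]
      refine sum_mem fun j _ => ?_
      rw [smul_eq_C_mul, map_mul]
      exact Ideal.mul_mem_left _ _ (hX j)
    have h2 := (mem_nilradical.1 h1).map E
    have h3 : E (Ideal.Quotient.mk (symmIdeal F ^ s) ((linSubstEquiv V hV).symm (X i))) =
        Ideal.Quotient.mk _ (linSubstEquiv V hV ((linSubstEquiv V hV).symm (X i))) := rfl
    rw [h3, AlgEquiv.apply_symm_apply] at h2
    exact h2

end Field

end General

/-! ### Nonvanishing of the genericity polynomial and the final formula -/

theorem exists_genericityPoly_ne_zero (k : Type*) [Field k] :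
    ∃ f : Fin 4 → MvPolynomial (Fin 3) k,
      (∀ j, (f j).IsHomogeneous 2) ∧ genericityPoly (quadCoeffs f) ≠ 0 := by
  classical
  -- p = 0 serves outside characteristic 2, and p = 1 in characteristic 2.
  obtain ⟨p, hp⟩ : ∃ p : k, p ^ 2 + 4 ≠ 0 := by
    by_contra! h
    have h0 := h 0
    have h1 := h 1
    refine one_ne_zero (α := k) ?_
    linear_combination h1 - h0
  have hhom (a b c : ℕ) (h : a + b + c = 2) (r : k) :
      (monomial (expVec a b c) r).IsHomogeneous 2 :=
    isHomogeneous_monomial _ (by rw [expVec_degree, h])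
  -- These forms xz, yz, z² - x², y² - x² - p xy have identity `mainCoeffs`. Their pencil contains
  -- the identity matrix, and its cubic t³ - p t² - t has discriminant p² + 4.
  refine ⟨![monomial (expVec 1 0 1) 1, monomial (expVec 0 1 1) 1,
    monomial (expVec 0 0 2) 1 - monomial (expVec 2 0 0) 1,
    monomial (expVec 0 2 0) 1 - monomial (expVec 2 0 0) 1 - monomial (expVec 1 1 0) p], ?_, ?_⟩
  · intro j
    fin_cases j
    · exact hhom 1 0 1 rfl 1
    · exact hhom 0 1 1 rfl 1
    · exact (hhom 0 0 2 rfl 1).sub (hhom 2 0 0 rfl 1)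
    · exact ((hhom 0 2 0 rfl 1).sub (hhom 2 0 0 rfl 1)).sub (hhom 1 1 0 rfl p)
  · generalize hf : (![monomial (expVec 1 0 1) 1, monomial (expVec 0 1 1) 1,
      monomial (expVec 0 0 2) 1 - monomial (expVec 2 0 0) 1,
      monomial (expVec 0 2 0) 1 - monomial (expVec 2 0 0) 1 - monomial (expVec 1 1 0) p] :
        Fin 4 → MvPolynomial (Fin 3) k) = f
    have hN : mainCoeffs (quadCoeffs f) = 1 := by
      rw [← hf]
      ext i j
      fin_cases i <;> fin_cases j <;>
        simp [mainCoeffs, quadCoeffs, mainMonomial, coeff_monomial, expVec_inj]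
    have hM : restCoeffs (quadCoeffs f) = !![0, 0; 0, 0; -1, 0; -1, -p] := by
      rw [← hf]
      ext i j
      fin_cases i <;> fin_cases j <;>
        simp [restCoeffs, quadCoeffs, restMonomial, coeff_monomial, expVec_inj]
    have hW : annihilator (quadCoeffs f) = !![0, 0; 0, 0; 1, 0; 1, p] := by
      rw [annihilator, hN, hM, Matrix.adjugate_one, Matrix.one_mul]
      ext i j
      fin_cases i <;> fin_cases j <;> simp
    have hA : annihilatorForm (quadCoeffs f) 0 = 1 := by
      rw [annihilatorForm, hW, hN]
      ext i j
      fin_cases i <;> fin_cases j <;> simp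
    have hB : annihilatorForm (quadCoeffs f) 1 = !![0, 1, 0; 1, p, 0; 0, 0, 0] := by
      rw [annihilatorForm, hW, hN]
      ext i j
      fin_cases i <;> fin_cases j <;> simp
    have hC : pencilCubic 1 !![0, 1, 0; 1, p, 0; 0, 0, 0] = ⟨1, -p, -1, 0⟩ := by
      simp [pencilCubic, Matrix.det_fin_three, Matrix.trace_fin_three, Matrix.adjugate_fin_three]
    rw [genericityPoly, hN, hA, hB, hC, Matrix.det_one, Matrix.det_one, one_mul, one_mul,
      Cubic.discr]
    convert hp using 1
    ring

theorem aeval_genericityPoly {k K : Type*} [Field k] [Field K] [Algebra k K]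
    (c : Fin 4 × QuadMonomial 3 → K) :
    aeval c (genericityPoly (X : _ → MvPolynomial (Fin 4 × QuadMonomial 3) k)) =
      genericityPoly c := by
  have hc : (aeval c : _ →ₐ[k] K).toRingHom ∘
      (X : _ → MvPolynomial (Fin 4 × QuadMonomial 3) k) = c := by
    ext i
    simp
  have h := genericityPoly_map (X : _ → MvPolynomial (Fin 4 × QuadMonomial 3) k)
    (aeval c : _ →ₐ[k] K).toRingHom
  rw [hc] at h
  exact h.symm

theorem six_mul_choose_three (n : ℕ) : 6 * (n + 2).choose 3 = (n + 2) * (n + 1) * n := by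
  induction n with
  | zero => rfl
  | succ n ih =>
    rw [show n + 1 + 2 = (n + 2) + 1 by ring, Nat.choose_succ_succ' (n + 2) 2, mul_add, ih]
    have h : (n + 2).choose 2 * 2 = (n + 2) * (n + 1) := by
      rw [Nat.choose_two_right]
      exact Nat.div_mul_cancel (Nat.even_mul_pred_self (n + 2)).two_dvd
    linear_combination 3 * h

theorem eq_alternating_sum_choose {s l : ℕ} (hl : l + 1 = (2 * s + 2).choose 3 + 3 * s) :
    (l : ℤ) = ∑ i : Fin (3 + 1), (-1) ^ (i : ℕ) * (![8, 4, 3, 1] : Fin (3 + 1) → ℤ) i *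
      (Nat.choose (s + 3 - (i : ℕ) - 1) (3 - (i : ℕ)) : ℤ) := by
  have h1 := six_mul_choose_three (2 * s)
  have h2 := six_mul_choose_three s
  have h3 : (s + 1).choose 2 * 2 = (s + 1) * s := by
    rw [Nat.choose_two_right]
    exact Nat.div_mul_cancel (Nat.even_mul_pred_self (s + 1)).two_dvd
  rw [Fin.sum_univ_four]
  simp only [Fin.val_zero, Fin.val_one, Fin.val_two, show ((3 : Fin 4) : ℕ) = 3 from rfl,
    Matrix.cons_val_zero, Matrix.cons_val_one, Matrix.cons_val]
  rw [show s + 3 - 0 - 1 = s + 2 by lia, show s + 3 - 1 - 1 = s + 1 by lia,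
    show s + 3 - 2 - 1 = s by lia, show 3 - 0 = 3 from rfl, show 3 - 1 = 2 from rfl,
    show 3 - 2 = 1 from rfl, show 3 - 3 = 0 from rfl, Nat.choose_one_right, Nat.choose_zero_right]
  zify at h1 h2 h3 hl
  push_cast
  linarith

/-- The Hilbert coefficients of the ideal generated by four general quadratic forms in three
variables. "General" means: off the zero locus of a polynomial `P` in the coefficients of the
forms, where this locus does not contain all quadruples of quadratic forms over `k`. The same `P`
works for forms over any extension field `K` of `k`, in particular for `K = k`. -/
theorem mainTheorem4 (k : Type*) [Field k] :
    ∃ P : MvPolynomial (Fin 4 × QuadMonomial 3) k,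
      (∃ f : Fin 4 → MvPolynomial (Fin 3) k,
        (∀ j, (f j).IsHomogeneous 2) ∧ MvPolynomial.aeval (quadCoeffs f) P ≠ 0) ∧
      ∀ (K : Type*) [Field K] [Algebra k K] (f : Fin 4 → MvPolynomial (Fin 3) K),
        (∀ j, (f j).IsHomogeneous 2) →
        MvPolynomial.aeval (quadCoeffs f) P ≠ 0 →
        IsHilbertCoefficients (Ideal.span (Set.range f)) ![8, 4, 3, 1] := by
  refine ⟨genericityPoly X, ?_, ?_⟩
  · obtain ⟨f, hf, h⟩ := exists_genericityPoly_ne_zero k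
    exact ⟨f, hf, by rwa [aeval_genericityPoly]⟩
  intro K _ _ f hf h
  rw [aeval_genericityPoly] at h
  let L := AlgebraicClosure K
  let f' : Fin 4 → MvPolynomial (Fin 3) L := fun j => map (algebraMap K L) (f j)
  have hf' (j) : (f' j).IsHomogeneous 2 := (hf j).map _
  have hc : quadCoeffs f' = algebraMap K L ∘ quadCoeffs f := by
    ext i
    simp [quadCoeffs, f', coeff_map]
  have h' : genericityPoly (quadCoeffs f') ≠ 0 := by
    rw [hc, genericityPoly_map]
    exact (map_ne_zero _).2 h
  have hmap (s : ℕ) : (Ideal.span (Set.range f) ^ s).map (map (algebraMap K L)) =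
      Ideal.span (Set.range f') ^ s := by
    rw [Ideal.map_pow, Ideal.map_span, ← Set.range_comp]
    rfl
  -- The formula already holds from s = 1 on; it fails at s = 0, where the quotient is zero and the
  -- sum is -1.
  filter_upwards [Filter.eventually_gt_atTop 0] with s hs
  obtain ⟨hrank, hnil⟩ := finrank_quotient_span_pow hf' h' hs
  rw [← hmap, finrank_quotient_map] at hrank
  rw [← hmap] at hnil
  exact ⟨_, length_quotient_eq_finrank (fun i => isNilpotent_mk_X_of_map L _ i (hnil i)) (by lia),
    eq_alternating_sum_choose hrank⟩
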